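/- For integers $n\ge 0$ and $0\le m\le 2^n$ let $[2^n:m]$ be Stern's diatomic integer, defined by $[2^0:0]=0$, $[2^0:1]=1$, $[2^{n+1}:2m]=[2^n:m]$ for $0\le m\le 2^n$, and $[2^{n+1}:2m+1]=[2^n:m]+[2^n:m+1]$ for $0\le m\le 2^n-1$. The assembly function $\mathcal A:[0,1]\to[0,\infty]$ is the unique continuous extension to $[0,1)$ of the map $$\frac{m}{2^n}\longmapsto\frac{[2^n:m]}{[2^n:2^n-m]}\qquad(n\ge 0,\ 0\le m\le 2^n-1),$$ together with $\mathcal A(1)=\infty$. An infinite design is an infinite word $D=d_1d_2d_3\cdots$ with $d_i\in\{0,1\}$ in which both $0$ and $1$ occur infinitely often, and its design decimal is $\theta_D=\sum_{i\ge1}d_i2^{-i}$. The infinite design $D$ is purely periodic with period $P$ if $P$ is a nonempty finite word in the letters $0,1$ such that $D=PPP\cdots$. The period $P$ is palindromic if it reads the same forwards and backwards. A quadratic irrational number is an irrational real number that is a root of a polynomial of degree $2$ with integer coefficients. Let $Q$ be a positive rational number. Then $\sqrt Q$ is a quadratic irrational number if and only if there exists a purely periodic design $D$ with a palindromic period such that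 $\sqrt Q=\mathcal A(\theta_D)$. -/

import Mathlib

namespace SternDesign

/-- Stern's diatomic integer `[2^n : m]`, of depth `n` and order `m`, for `0 ≤ m ≤ 2^n`
(the values for `m > 2^n` carry no meaning and are never used). -/
def sdi : ℕ → ℕ → ℕ
  | 0, m => if m = 1 then 1 else 0
  | n + 1, m => if m % 2 = 0 then sdi n (m / 2) else sdi n (m / 2) + sdi n (m / 2 + 1)

theorem sdi_zero_zero : sdi 0 0 = 0 := rfl

theorem sdi_zero_one : sdi 0 1 = 1 := rfl

theorem sdi_succ_even (n m : ℕ) : sdi (n + 1) (2 * m) = sdi n m := by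
  simp [sdi]

theorem sdi_succ_odd (n m : ℕ) : sdi (n + 1) (2 * m + 1) = sdi n m + sdi n (m + 1) := by
  have h1 : (2 * m + 1) % 2 = 1 := by omega
  have h2 : (2 * m + 1) / 2 = m := by omega
  simp [sdi, h1, h2]

theorem sdi_add_pow_mul (n k m : ℕ) : sdi (n + k) (2 ^ k * m) = sdi n m := by
  induction k with
  | zero => simp
  | succ k ih => rw [← add_assoc, pow_succ', mul_assoc, sdi_succ_even, ih]

/-- The set `S` of the dyadic rationals `m / 2^n` with `0 ≤ m ≤ 2^n - 1`. -/
def dyadicSet : Set ℝ := {x | ∃ p : ℕ × ℕ, p.2 < 2 ^ p.1 ∧ x = (p.2 : ℝ) / 2 ^ p.1}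

open Classical in
/-- The rational assembly function `m / 2^n ↦ [2^n : m] / [2^n : 2^n - m]` on `dyadicSet`.
It does not depend on the chosen representation, see `rationalAssembly_eq`. -/
noncomputable def rationalAssembly (x : ℝ) : ℝ :=
  if h : x ∈ dyadicSet then
    (sdi h.choose.1 h.choose.2 : ℝ) / (sdi h.choose.1 (2 ^ h.choose.1 - h.choose.2) : ℝ)
  else 0

theorem sdi_ratio_eq {n k m m' : ℕ} (h : (m : ℝ) / 2 ^ n = (m' : ℝ) / 2 ^ (n + k)) :
    (sdi n m : ℝ) / (sdi n (2 ^ n - m) : ℝ) =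
      (sdi (n + k) m' : ℝ) / (sdi (n + k) (2 ^ (n + k) - m') : ℝ) := by
  have h1 : (m' : ℝ) = 2 ^ k * m := by
    rw [pow_add] at h
    field_simp at h
    linarith
  have h2 : m' = 2 ^ k * m := by exact_mod_cast h1
  subst h2
  have h3 : 2 ^ (n + k) - 2 ^ k * m = 2 ^ k * (2 ^ n - m) := by
    rw [Nat.mul_sub, pow_add, mul_comm (2 ^ n)]
  rw [h3, sdi_add_pow_mul, sdi_add_pow_mul]

theorem rationalAssembly_eq {n m : ℕ} (hm : m < 2 ^ n) :
    rationalAssembly ((m : ℝ) / 2 ^ n) = (sdi n m : ℝ) / (sdi n (2 ^ n - m) : ℝ) := by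
  have h : (m : ℝ) / 2 ^ n ∈ dyadicSet := ⟨(n, m), hm, rfl⟩
  have hs := h.choose_spec.2
  rw [rationalAssembly, dif_pos h]
  rcases Nat.le_total n h.choose.1 with hle | hle
  · obtain ⟨k, hk⟩ := Nat.exists_eq_add_of_le hle
    rw [hk] at hs ⊢
    exact (sdi_ratio_eq hs).symm
  · obtain ⟨k, hk⟩ := Nat.exists_eq_add_of_le hle
    have := sdi_ratio_eq (n := h.choose.1) (k := k) (m := h.choose.2) (m' := m)
      (by rw [← hk]; exact hs.symm)
    rwa [← hk] at this

/-- The assembly function `𝒜 : [0, 1] → [0, ∞]`: on `[0, 1)` the continuous extension of the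
rational assembly function from `dyadicSet`, and `𝒜(1) = ∞`. Arguments outside `[0, 1]` carry
no meaning. -/
noncomputable def assembly (θ : ℝ) : EReal :=
  open Classical in
  if θ = 1 then ⊤ else ((extendFrom dyadicSet rationalAssembly θ : ℝ) : EReal)

/-- An infinite design `1⋯1 0⋯0 1⋯1 0⋯0 ⋯` with runs of lengths `k₀ ≥ 0` and `k₁, k₂, … ≥ 1`:
an infinite dyadic word all of whose runs are finite, that is, in which both letters occur
infinitely often. -/
structure InfiniteDesign where
  digit : ℕ → Fin 2
  exists_one : ∀ N : ℕ, ∃ i : ℕ, N ≤ i ∧ digit i = 1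
  exists_zero : ∀ N : ℕ, ∃ i : ℕ, N ≤ i ∧ digit i = 0

/-- The design decimal `θ_D = 0.d₁d₂d₃⋯` in base two. -/
noncomputable def InfiniteDesign.decimal (D : InfiniteDesign) : ℝ := Real.ofDigits D.digit

/-- `D = PPP⋯` for the nonempty finite word `P`: the infinite design `D` is purely periodic
with period `P`. -/
def InfiniteDesign.IsPurelyPeriodicWith (D : InfiniteDesign) (P : List (Fin 2)) : Prop :=
  P ≠ [] ∧ ∀ i : ℕ, P[i % P.length]? = some (D.digit i)

/-- A quadratic irrational number: an irrational real root of a quadratic polynomial with integer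
coefficients. -/
def IsQuadraticIrrational (x : ℝ) : Prop :=
  Irrational x ∧ ∃ a b c : ℤ, a ≠ 0 ∧ (a : ℝ) * x ^ 2 + b * x + c = 0

end SternDesign

/-!
# Square roots of rationals as assembled numbers of palindromic designs

Prefixing a digit to a binary expansion acts on values of the assembly function by a Möbius
transformation: `𝒜(y / 2) = 𝒜(y) / (1 + 𝒜(y))` and `𝒜((1 + y) / 2) = 𝒜(y) + 1` on dyadic
rationals, with matrices `L = !![1, 0; 1, 1]` and `R = !![1, 1; 0, 1]`. Hence a purely periodic
design with period `P` is sent to the positive fixed point of the Möbius transformation of the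
product `M` of the matrices of the letters of `P`. Indeed, this transformation contracts `[0, ∞)`
towards its fixed point, so the values of `𝒜` on dyadic rationals near the design decimal converge
to it (`assembly_decimal_eq`).

Reflection in the antidiagonal is an anti-automorphism that fixes `L` and `R`, so it
corresponds to the reversal of words. As `L` and `R` freely generate the monoid `SL₂(ℕ)`
(`exists_wordMatrix_eq`, `wordMatrix_injective`), a word is a palindrome exactly when its matrix
`!![a, b; c, d]` satisfies `a = d` (`palindrome_iff_wordMatrix`); and then the positive fixed
point is `√(b / c)`, with `b * c = a ^ 2 - 1`.

* If the period is palindromic, then `a ≥ 2`, so `a ^ 2 - 1` is not a square and `√(b / c)` is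
  irrational.
* If `√(p / q)` is irrational, Pell's equation `x ^ 2 - p * q * y ^ 2 = 1` has a solution with
  `x, y > 0`, and `!![x, p * y; q * y, x]` is the matrix of a palindromic period for `√(p / q)`.
-/

open Filter Topology

namespace SternDesign

/-! ### Symmetries of Stern's diatomic integers -/

theorem sdi_succ_of_le {n : ℕ} : ∀ {m : ℕ}, m ≤ 2 ^ n → sdi (n + 1) m = sdi n m := by
  induction n with
  | zero =>
    intro m hm
    have : m = 0 ∨ m = 1 := by simp at hm; omega
    rcases this with rfl | rfl <;> simp [sdi]
  | succ n ih =>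
    intro m hm
    rw [pow_succ] at hm
    obtain ⟨j, rfl | rfl⟩ := Nat.even_or_odd' m
    · rw [sdi_succ_even, sdi_succ_even, ih (by omega)]
    · rw [sdi_succ_odd, sdi_succ_odd, ih (by omega), ih (by omega)]

theorem sdi_succ_pow_add {n : ℕ} :
    ∀ {k : ℕ}, k ≤ 2 ^ n → sdi (n + 1) (2 ^ n + k) = sdi n k + sdi n (2 ^ n - k) := by
  induction n with
  | zero =>
    intro k hk
    have : k = 0 ∨ k = 1 := by simp at hk; omega
    rcases this with rfl | rfl <;> simp [sdi]
  | succ n ih =>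
    intro k hk
    rw [pow_succ] at hk
    obtain ⟨j, rfl | rfl⟩ := Nat.even_or_odd' k
    · rw [show 2 ^ (n + 1) + 2 * j = 2 * (2 ^ n + j) by ring,
        show 2 ^ (n + 1) - 2 * j = 2 * (2 ^ n - j) by rw [pow_succ]; omega,
        sdi_succ_even, sdi_succ_even, sdi_succ_even, ih (by omega)]
    · rw [show 2 ^ (n + 1) + (2 * j + 1) = 2 * (2 ^ n + j) + 1 by ring,
        show 2 ^ (n + 1) - (2 * j + 1) = 2 * (2 ^ n - (j + 1)) + 1 by rw [pow_succ]; omega,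
        sdi_succ_odd, sdi_succ_odd, sdi_succ_odd, ih (by omega), add_assoc (2 ^ n) j 1,
        ih (by omega), show 2 ^ n - (j + 1) + 1 = 2 ^ n - j by omega]
      ring

theorem sdi_pos {n : ℕ} : ∀ {m : ℕ}, 0 < m → m ≤ 2 ^ n → 0 < sdi n m := by
  induction n with
  | zero =>
    intro m h0 hm
    have : m = 1 := by simp at hm; omega
    simp [this, sdi]
  | succ n ih =>
    intro m h0 hm
    rw [pow_succ] at hm
    obtain ⟨j, rfl | rfl⟩ := Nat.even_or_odd' m
    · rw [sdi_succ_even]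
      exact ih (by omega) (by omega)
    · rw [sdi_succ_odd]
      have := ih (m := j + 1) (by omega) (by omega)
      omega

/-! ### Prefixing digits -/

/-- The map `0.d₁d₂⋯ ↦ 0.dd₁d₂⋯` on binary expansions. -/
noncomputable def prependDigit (d : Fin 2) (y : ℝ) : ℝ := ((d : ℕ) + y) / 2

/-- The Möbius transformation by which prefixing the digit `d` acts on the values of the assembly
function. -/
noncomputable def digitAction (d : Fin 2) (x : ℝ) : ℝ := if d = 0 then x / (1 + x) else x + 1

theorem rationalAssembly_nonneg (y : ℝ) : 0 ≤ rationalAssembly y := by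
  unfold rationalAssembly
  split_ifs <;> positivity

theorem rationalAssembly_prependDigit (d : Fin 2) {y : ℝ} (hy : y ∈ dyadicSet) :
    rationalAssembly (prependDigit d y) = digitAction d (rationalAssembly y) := by
  obtain ⟨⟨n, m⟩, hm, rfl⟩ := hy
  dsimp only at hm ⊢
  have hs : (0 : ℝ) < sdi n (2 ^ n - m) :=
    Nat.cast_pos.2 (sdi_pos (Nat.sub_pos_of_lt hm) (Nat.sub_le _ _))
  have hp : 2 ^ (n + 1) = 2 ^ n + 2 ^ n := by ring
  rw [rationalAssembly_eq hm]
  fin_cases d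
  · have h : prependDigit 0 ((m : ℝ) / 2 ^ n) = (m : ℝ) / 2 ^ (n + 1) := by
      simp [prependDigit, pow_succ]; ring
    simp only [Fin.zero_eta]
    rw [h, rationalAssembly_eq (by omega), sdi_succ_of_le hm.le,
      show 2 ^ (n + 1) - m = 2 ^ n + (2 ^ n - m) by omega, sdi_succ_pow_add (Nat.sub_le _ _),
      Nat.sub_sub_self hm.le]
    simp only [digitAction, if_true]
    push_cast
    field_simp
  · have h : prependDigit 1 ((m : ℝ) / 2 ^ n) = ((2 ^ n + m : ℕ) : ℝ) / 2 ^ (n + 1) := by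
      simp [prependDigit, pow_succ]; field_simp
    simp only [Fin.mk_one]
    rw [h, rationalAssembly_eq (by omega), sdi_succ_pow_add hm.le,
      show 2 ^ (n + 1) - (2 ^ n + m) = 2 ^ n - m by omega, sdi_succ_of_le (Nat.sub_le _ _)]
    simp only [digitAction, one_ne_zero, if_false]
    push_cast
    field_simp

theorem dyadicSet_of_prependDigit {d : Fin 2} {y : ℝ} (h : prependDigit d y ∈ dyadicSet)
    (h0 : 0 ≤ y) (h1 : y < 1) : y ∈ dyadicSet := by
  obtain ⟨⟨n, m⟩, hm, h⟩ := h
  dsimp only at hm h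
  have hp : (0 : ℝ) < 2 ^ n := by positivity
  have hy : y = (2 * m - (d : ℕ) * 2 ^ n) / 2 ^ n := by
    unfold prependDigit at h
    field_simp at h ⊢
    linarith
  have hle : (d : ℕ) * 2 ^ n ≤ 2 * m := by
    rw [hy, le_div_iff₀ hp] at h0
    have : ((d : ℕ) : ℝ) * 2 ^ n ≤ 2 * m := by linarith
    exact_mod_cast this
  have hy' : y = ((2 * m - (d : ℕ) * 2 ^ n : ℕ) : ℝ) / 2 ^ n := by
    rw [hy]; push_cast [hle]; rfl
  refine ⟨(n, 2 * m - (d : ℕ) * 2 ^ n), ?_, hy'⟩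
  rw [hy', div_lt_one hp] at h1
  exact_mod_cast h1

theorem prependDigit_mem_Ioo (d : Fin 2) {y : ℝ} (hy : y ∈ Set.Ioo (0 : ℝ) 1) :
    prependDigit d y ∈ Set.Ioo (0 : ℝ) 1 := by
  obtain ⟨h0, h1⟩ := hy
  fin_cases d <;> constructor <;> simp [prependDigit] <;> linarith

/-- Every dyadic rational near `prependDigit d θ` arises by prefixing `d` to a dyadic rational
near `θ`. -/
theorem eventually_prependDigit {d : Fin 2} {θ : ℝ} (hθ : θ ∈ Set.Ioo (0 : ℝ) 1) {p : ℝ → Prop}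
    (h : ∀ᶠ y in 𝓝[dyadicSet] θ, p (digitAction d (rationalAssembly y))) :
    ∀ᶠ y in 𝓝[dyadicSet] (prependDigit d θ), p (rationalAssembly y) := by
  have hinv : ∀ y, prependDigit d (2 * y - (d : ℕ)) = y := fun y => by
    unfold prependDigit; ring
  have hc : Tendsto (fun y : ℝ => 2 * y - (d : ℕ)) (𝓝[dyadicSet] (prependDigit d θ)) (𝓝 θ) := by
    have : Continuous fun y : ℝ => 2 * y - (d : ℕ) := by fun_prop
    have h2 := this.tendsto (prependDigit d θ)
    rw [show 2 * prependDigit d θ - (d : ℕ) = θ by unfold prependDigit; ring] at h2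
    exact h2.mono_left nhdsWithin_le_nhds
  have hm : ∀ᶠ y : ℝ in 𝓝[dyadicSet] (prependDigit d θ), 2 * y - (d : ℕ) ∈ dyadicSet := by
    filter_upwards [hc (isOpen_Ioo.mem_nhds hθ), self_mem_nhdsWithin] with y hy hyD
    exact dyadicSet_of_prependDigit (by rwa [hinv]) hy.1.le hy.2
  filter_upwards [(tendsto_nhdsWithin_iff.2 ⟨hc, hm⟩).eventually h, hm] with y hy hyD
  rwa [← rationalAssembly_prependDigit d hyD, hinv] at hy

theorem foldr_prependDigit_mem_Ioo (w : List (Fin 2)) {y : ℝ} (hy : y ∈ Set.Ioo (0 : ℝ) 1) :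
    w.foldr prependDigit y ∈ Set.Ioo (0 : ℝ) 1 := by
  induction w with
  | nil => exact hy
  | cons d w ih => exact prependDigit_mem_Ioo d ih

theorem eventually_foldr_prependDigit (w : List (Fin 2)) {θ : ℝ} (hθ : θ ∈ Set.Ioo (0 : ℝ) 1)
    {p : ℝ → Prop} (h : ∀ᶠ y in 𝓝[dyadicSet] θ, p (w.foldr digitAction (rationalAssembly y))) :
    ∀ᶠ y in 𝓝[dyadicSet] (w.foldr prependDigit θ), p (rationalAssembly y) := by
  induction w generalizing p with
  | nil => exact h
  | cons d w ih =>
    exact eventually_prependDigit (foldr_prependDigit_mem_Ioo w hθ)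
      (ih (p := fun x => p (digitAction d x)) h)

theorem mem_closure_dyadicSet {θ : ℝ} (h0 : 0 ≤ θ) (h1 : θ < 1) : θ ∈ closure dyadicSet := by
  have ht : Tendsto (fun n : ℕ => (⌊θ * 2 ^ n⌋₊ : ℝ) / 2 ^ n) atTop (𝓝 θ) :=
    (tendsto_nat_floor_mul_div_atTop h0).comp
      (tendsto_pow_atTop_atTop_of_one_lt (one_lt_two : (1 : ℝ) < 2))
  refine mem_closure_of_tendsto ht (Eventually.of_forall fun n => ⟨(n, ⌊θ * 2 ^ n⌋₊), ?_, rfl⟩)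
  have hp : (0 : ℝ) < 2 ^ n := by positivity
  rw [Nat.floor_lt (by positivity)]
  push_cast
  nlinarith

/-! ### The free monoid of words and `SL₂(ℕ)` -/

/-- The matrix of the Möbius transformation `digitAction d`. -/
def letterMatrix (d : Fin 2) : Matrix (Fin 2) (Fin 2) ℕ :=
  if d = 0 then !![1, 0; 1, 1] else !![1, 1; 0, 1]

/-- The product of the letter matrices of a word. -/
def wordMatrix (w : List (Fin 2)) : Matrix (Fin 2) (Fin 2) ℕ := (w.map letterMatrix).prod

theorem wordMatrix_nil : wordMatrix [] = 1 := rfl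

theorem wordMatrix_cons (d : Fin 2) (w : List (Fin 2)) :
    wordMatrix (d :: w) = letterMatrix d * wordMatrix w := by
  simp [wordMatrix]

theorem wordMatrix_zero_cons (w : List (Fin 2)) :
    wordMatrix (0 :: w) = !![wordMatrix w 0 0, wordMatrix w 0 1;
      wordMatrix w 0 0 + wordMatrix w 1 0, wordMatrix w 0 1 + wordMatrix w 1 1] := by
  rw [wordMatrix_cons]
  ext i j
  fin_cases i <;> fin_cases j <;> simp [letterMatrix, Matrix.mul_apply, Fin.sum_univ_two]

theorem wordMatrix_one_cons (w : List (Fin 2)) :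
    wordMatrix (1 :: w) = !![wordMatrix w 0 0 + wordMatrix w 1 0,
      wordMatrix w 0 1 + wordMatrix w 1 1; wordMatrix w 1 0, wordMatrix w 1 1] := by
  rw [wordMatrix_cons]
  ext i j
  fin_cases i <;> fin_cases j <;> simp [letterMatrix, Matrix.mul_apply, Fin.sum_univ_two]

theorem wordMatrix_det (w : List (Fin 2)) :
    wordMatrix w 0 0 * wordMatrix w 1 1 = wordMatrix w 0 1 * wordMatrix w 1 0 + 1 := by
  induction w with
  | nil => simp [wordMatrix_nil]
  | cons d w ih =>
    obtain rfl | rfl : d = 0 ∨ d = 1 := by omega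
    · simp only [wordMatrix_zero_cons, Matrix.of_apply, Matrix.cons_val', Matrix.cons_val_zero,
        Matrix.cons_val_one, Matrix.cons_val_fin_one]
      linear_combination ih
    · simp only [wordMatrix_one_cons, Matrix.of_apply, Matrix.cons_val', Matrix.cons_val_zero,
        Matrix.cons_val_one, Matrix.cons_val_fin_one]
      linear_combination ih

theorem wordMatrix_diag_pos (w : List (Fin 2)) : 0 < wordMatrix w 0 0 ∧ 0 < wordMatrix w 1 1 := by
  have h := wordMatrix_det w
  constructor <;> rw [Nat.pos_iff_ne_zero] <;> intro h0 <;> simp [h0] at h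

theorem wordMatrix_zero_one_pos_iff (w : List (Fin 2)) : 0 < wordMatrix w 0 1 ↔ 1 ∈ w := by
  induction w with
  | nil => simp [wordMatrix_nil]
  | cons d w ih =>
    have := wordMatrix_diag_pos w
    obtain rfl | rfl : d = 0 ∨ d = 1 := by omega
    · simp [wordMatrix_zero_cons, ih]
    · simp [wordMatrix_one_cons, this.2]

theorem wordMatrix_one_zero_pos_iff (w : List (Fin 2)) : 0 < wordMatrix w 1 0 ↔ 0 ∈ w := by
  induction w with
  | nil => simp [wordMatrix_nil]
  | cons d w ih =>
    have := wordMatrix_diag_pos w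
    obtain rfl | rfl : d = 0 ∨ d = 1 := by omega
    · simp [wordMatrix_zero_cons, this.1]
    · simp [wordMatrix_one_cons, ih]

/-- Every matrix of determinant one with natural entries is the matrix of a word: unless it is the
identity, one of its rows dominates the other and can be reduced by it. -/
theorem exists_wordMatrix_eq {a b c d : ℕ} (h : a * d = b * c + 1) :
    ∃ w, wordMatrix w = !![a, b; c, d] := by
  induction hN : a + b + c + d using Nat.strong_induction_on generalizing a b c d with
  | _ N ih =>
    have had : 0 < a ∧ 0 < d := by
      constructor <;> rw [Nat.pos_iff_ne_zero] <;> rintro rfl <;> simp at h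
    by_cases h1 : c ≤ a ∧ d ≤ b
    · obtain ⟨⟨a, rfl⟩, ⟨b, rfl⟩⟩ :=
        And.intro (Nat.exists_eq_add_of_le h1.1) (Nat.exists_eq_add_of_le h1.2)
      obtain ⟨w, hw⟩ := ih (a + b + c + d) (by omega) (a := a) (b := b) (c := c) (d := d)
        (by linarith) rfl
      exact ⟨1 :: w, by simp [wordMatrix_one_cons, hw, add_comm]⟩
    by_cases h2 : a ≤ c ∧ b ≤ d
    · obtain ⟨⟨c, rfl⟩, ⟨d, rfl⟩⟩ :=
        And.intro (Nat.exists_eq_add_of_le h2.1) (Nat.exists_eq_add_of_le h2.2)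
      obtain ⟨w, hw⟩ := ih (a + b + c + d) (by omega) (a := a) (b := b) (c := c) (d := d)
        (by linarith) rfl
      exact ⟨0 :: w, by simp [wordMatrix_zero_cons, hw]⟩
    -- The rows are incomparable, which the determinant allows only for the identity matrix.
    have h3 : c + 1 ≤ a ∧ b + 1 ≤ d := by
      by_contra h3
      have h4 : a + 1 ≤ c ∧ d + 1 ≤ b := by omega
      have := Nat.mul_le_mul h4.1 h4.2
      nlinarith
    have h4 := Nat.mul_le_mul h3.1 h3.2
    have hb : b = 0 := by nlinarith
    have hc : c = 0 := by nlinarith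
    subst hb hc
    have : a = 1 ∧ d = 1 := by simpa using h
    refine ⟨[], ?_⟩
    rw [this.1, this.2, wordMatrix_nil, Matrix.one_fin_two]

theorem wordMatrix_injective : Function.Injective wordMatrix := by
  have key : ∀ v w : List (Fin 2), wordMatrix v 0 0 = wordMatrix w 0 0 →
      wordMatrix v 0 1 = wordMatrix w 0 1 → wordMatrix v 1 0 = wordMatrix w 1 0 →
      wordMatrix v 1 1 = wordMatrix w 1 1 → v = w := by
    intro v
    induction v with
    | nil =>
      intro w h1 h2 h3 h4
      cases w with
      | nil => rfl
      | cons e w =>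
        have := wordMatrix_diag_pos w
        obtain rfl | rfl : e = 0 ∨ e = 1 := by omega
        · simp [wordMatrix_nil, wordMatrix_zero_cons] at h3; omega
        · simp [wordMatrix_nil, wordMatrix_one_cons] at h2; omega
    | cons d v ih =>
      intro w h1 h2 h3 h4
      have hv := wordMatrix_diag_pos v
      cases w with
      | nil =>
        obtain rfl | rfl : d = 0 ∨ d = 1 := by omega
        · simp [wordMatrix_nil, wordMatrix_zero_cons] at h3; omega
        · simp [wordMatrix_nil, wordMatrix_one_cons] at h2; omega
      | cons e w =>
        have hw := wordMatrix_diag_pos w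
        have hd : d = 0 ∨ d = 1 := by omega
        have he : e = 0 ∨ e = 1 := by omega
        rcases hd with rfl | rfl <;> rcases he with rfl | rfl <;>
        simp [wordMatrix_zero_cons, wordMatrix_one_cons] at h1 h2 h3 h4
        · rw [ih w] <;> omega
        · omega
        · omega
        · rw [ih w] <;> omega
  intro v w h
  exact key v w (by rw [h]) (by rw [h]) (by rw [h]) (by rw [h])

theorem wordMatrix_reverse (w : List (Fin 2)) :
    wordMatrix w.reverse =
      !![wordMatrix w 1 1, wordMatrix w 0 1; wordMatrix w 1 0, wordMatrix w 0 0] := by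
  induction w with
  | nil => simp [wordMatrix_nil, Matrix.one_fin_two]
  | cons d w ih =>
    have h : wordMatrix (d :: w).reverse = wordMatrix w.reverse * letterMatrix d := by
      simp [wordMatrix]
    rw [h, ih]
    obtain rfl | rfl : d = 0 ∨ d = 1 := by omega
    · ext i j
      fin_cases i <;> fin_cases j <;>
        simp [wordMatrix_zero_cons, letterMatrix, add_comm]
    · ext i j
      fin_cases i <;> fin_cases j <;>
        simp [wordMatrix_one_cons, letterMatrix, add_comm]

theorem palindrome_iff_wordMatrix (w : List (Fin 2)) :
    w.Palindrome ↔ wordMatrix w 0 0 = wordMatrix w 1 1 := by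
  rw [List.Palindrome.iff_reverse_eq, ← wordMatrix_injective.eq_iff, wordMatrix_reverse]
  constructor
  · intro h
    simpa using (congrFun (congrFun h 1) 1)
  · intro h
    ext i j
    fin_cases i <;> fin_cases j <;> simp [h]

/-! ### The assembly function at a purely periodic design -/

theorem foldr_digitAction (w : List (Fin 2)) {x : ℝ} (hx : 0 ≤ x) :
    w.foldr digitAction x =
      (wordMatrix w 0 0 * x + wordMatrix w 0 1) / (wordMatrix w 1 0 * x + wordMatrix w 1 1) := by
  induction w with
  | nil => simp [wordMatrix_nil]
  | cons d w ih =>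
    have h1 : (0 : ℝ) < wordMatrix w 1 1 := Nat.cast_pos.2 (wordMatrix_diag_pos w).2
    have hd : (0 : ℝ) < wordMatrix w 1 0 * x + wordMatrix w 1 1 := by positivity
    rw [List.foldr_cons, ih]
    obtain rfl | rfl : d = 0 ∨ d = 1 := by omega
    · simp only [digitAction, if_true, wordMatrix_zero_cons, Matrix.of_apply, Matrix.cons_val',
        Matrix.cons_val_zero, Matrix.cons_val_one, Matrix.cons_val_fin_one]
      push_cast
      rw [one_add_div hd.ne', div_div_div_cancel_right₀ hd.ne']
      congr 1
      ring
    · simp only [digitAction, one_ne_zero, if_false, wordMatrix_one_cons, Matrix.of_apply,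
        Matrix.cons_val', Matrix.cons_val_zero, Matrix.cons_val_one, Matrix.cons_val_fin_one]
      push_cast
      rw [div_add_one hd.ne']
      congr 1
      ring

/-- The Möbius transformation of a word containing the letter `0` has bounded image, and it
contracts `[0, ∞)` towards a positive fixed point. -/
theorem exists_contraction {w : List (Fin 2)} (h0 : 0 ∈ w) {x : ℝ} (hx : 0 < x)
    (hfix : w.foldr digitAction x = x) :
    ∃ r C : ℝ, 0 ≤ r ∧ r < 1 ∧ ∀ t, 0 ≤ t →
      |w.foldr digitAction t - x| ≤ C ∧ |w.foldr digitAction t - x| ≤ r * |t - x| := by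
  have hc : (1 : ℝ) ≤ wordMatrix w 1 0 := by
    exact_mod_cast (wordMatrix_one_zero_pos_iff w).2 h0
  have hd : (1 : ℝ) ≤ wordMatrix w 1 1 := by exact_mod_cast (wordMatrix_diag_pos w).2
  have hdet : (wordMatrix w 0 0 : ℝ) * wordMatrix w 1 1
      = wordMatrix w 0 1 * wordMatrix w 1 0 + 1 := by exact_mod_cast wordMatrix_det w
  have hact := fun t (ht : (0 : ℝ) ≤ t) => foldr_digitAction w ht
  have ha : (0 : ℝ) ≤ wordMatrix w 0 0 := by positivity
  have hb : (0 : ℝ) ≤ wordMatrix w 0 1 := by positivity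
  generalize (wordMatrix w 0 0 : ℝ) = a, (wordMatrix w 0 1 : ℝ) = b,
    (wordMatrix w 1 0 : ℝ) = c, (wordMatrix w 1 1 : ℝ) = d at *
  have hcx : 1 < c * x + d := by nlinarith
  refine ⟨(c * x + d)⁻¹, a + b + x, by positivity, inv_lt_one_of_one_lt₀ hcx, fun t ht => ?_⟩
  have hct : 1 ≤ c * t + d := by nlinarith
  constructor
  · have h1 : w.foldr digitAction t ≤ a + b := by
      rw [hact t ht, div_le_iff₀ (by linarith)]
      nlinarith [mul_nonneg ha ht, mul_nonneg hb ht,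
        mul_nonneg (mul_nonneg ha ht) (sub_nonneg.2 hc),
        mul_nonneg (mul_nonneg hb ht) (sub_nonneg.2 hc), mul_nonneg ha (sub_nonneg.2 hd),
        mul_nonneg hb (sub_nonneg.2 hd)]
    have h2 : 0 ≤ w.foldr digitAction t := by
      rw [hact t ht]; positivity
    rw [abs_le]
    constructor <;> linarith
  · have h : w.foldr digitAction t - x = (c * x + d)⁻¹ * ((t - x) / (c * t + d)) := by
      conv_lhs => rw [← hfix]
      rw [hact t ht, hact x hx.le]
      field_simp
      linear_combination (t - x) * hdet
    rw [h, abs_mul, abs_of_pos (inv_pos.2 (by linarith : 0 < c * x + d))]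
    refine mul_le_mul_of_nonneg_left ?_ (inv_nonneg.2 (by linarith))
    rw [abs_div, abs_of_pos (by linarith : 0 < c * t + d)]
    exact div_le_self (abs_nonneg _) hct

theorem tendsto_rationalAssembly {w : List (Fin 2)} (h0 : 0 ∈ w) {x : ℝ} (hx : 0 < x)
    (hfix : w.foldr digitAction x = x) {θ : ℝ} (hθ : θ ∈ Set.Ioo (0 : ℝ) 1)
    (hθw : w.foldr prependDigit θ = θ) :
    Tendsto rationalAssembly (𝓝[dyadicSet] θ) (𝓝 x) := by
  obtain ⟨r, C, hr0, hr1, hC⟩ := exists_contraction h0 hx hfix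
  have key : ∀ k : ℕ, ∀ᶠ y in 𝓝[dyadicSet] θ, |rationalAssembly y - x| ≤ r ^ k * C := by
    intro k
    induction k with
    | zero =>
      rw [← hθw]
      refine eventually_foldr_prependDigit w hθ (p := fun z => |z - x| ≤ r ^ 0 * C)
        (Eventually.of_forall fun y => ?_)
      simpa using (hC _ (rationalAssembly_nonneg y)).1
    | succ k ih =>
      rw [← hθw]
      refine eventually_foldr_prependDigit w hθ (p := fun z => |z - x| ≤ r ^ (k + 1) * C) ?_
      filter_upwards [ih] with y hy
      calc _ ≤ r * |rationalAssembly y - x| := (hC _ (rationalAssembly_nonneg y)).2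
        _ ≤ r * (r ^ k * C) := by gcongr
        _ = r ^ (k + 1) * C := by ring
  rw [Metric.tendsto_nhds]
  intro ε hε
  have hlim : Tendsto (fun k : ℕ => r ^ k * C) atTop (𝓝 0) := by
    simpa using (tendsto_pow_atTop_nhds_zero_of_lt_one hr0 hr1).mul_const C
  obtain ⟨k, hk⟩ := (hlim.eventually (gt_mem_nhds hε)).exists
  filter_upwards [key k] with y hy
  rw [Real.dist_eq]
  exact hy.trans_lt hk

theorem ofDigits_eq_prependDigit (f : ℕ → Fin 2) :
    Real.ofDigits f = prependDigit (f 0) (Real.ofDigits fun i => f (i + 1)) := by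
  rw [Real.ofDigits_eq_sum_add_ofDigits f 1]
  simp [Real.ofDigitsTerm, prependDigit]
  ring

theorem ofDigits_eq_foldr (w : List (Fin 2)) (f : ℕ → Fin 2)
    (h : ∀ i < w.length, w[i]? = some (f i)) :
    Real.ofDigits f = w.foldr prependDigit (Real.ofDigits fun i => f (i + w.length)) := by
  induction w generalizing f with
  | nil => simp
  | cons d w ih =>
    have hd : d = f 0 := by simpa using h 0 (by simp)
    rw [ofDigits_eq_prependDigit, ih (fun i => f (i + 1)) (fun i hi => by
      simpa using h (i + 1) (by simpa using hi)), List.foldr_cons, hd]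
    simp only [List.length_cons, add_assoc]

theorem foldr_prependDigit_mem_Icc (w : List (Fin 2)) {y : ℝ} (hy : y ∈ Set.Icc (0 : ℝ) 1) :
    w.foldr prependDigit y ∈ Set.Icc (0 : ℝ) 1 := by
  induction w with
  | nil => exact hy
  | cons d w ih =>
    obtain ⟨h0, h1⟩ := ih
    obtain rfl | rfl : d = 0 ∨ d = 1 := by omega
    all_goals constructor <;> simp [prependDigit] <;> linarith

theorem foldr_prependDigit_pos {w : List (Fin 2)} (hw : 1 ∈ w) {y : ℝ}
    (hy : y ∈ Set.Icc (0 : ℝ) 1) : 0 < w.foldr prependDigit y := by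
  induction w with
  | nil => simp at hw
  | cons d w ih =>
    have h := foldr_prependDigit_mem_Icc w hy
    obtain rfl | rfl : d = 0 ∨ d = 1 := by omega
    · simpa [prependDigit] using ih (by simpa using hw)
    · simp [prependDigit]
      linarith [h.1]

theorem foldr_prependDigit_lt_one {w : List (Fin 2)} (hw : 0 ∈ w) {y : ℝ}
    (hy : y ∈ Set.Icc (0 : ℝ) 1) : w.foldr prependDigit y < 1 := by
  induction w with
  | nil => simp at hw
  | cons d w ih =>
    have h := foldr_prependDigit_mem_Icc w hy
    obtain rfl | rfl : d = 0 ∨ d = 1 := by omega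
    · simp [prependDigit]
      linarith [h.2]
    · have := ih (by simpa using hw)
      simp [prependDigit]
      linarith

variable {D : InfiniteDesign} {P : List (Fin 2)}

theorem InfiniteDesign.IsPurelyPeriodicWith.digit_mem (h : D.IsPurelyPeriodicWith P) (i : ℕ) :
    D.digit i ∈ P :=
  List.mem_of_getElem? (h.2 i)

theorem InfiniteDesign.IsPurelyPeriodicWith.zero_mem (h : D.IsPurelyPeriodicWith P) : 0 ∈ P := by
  obtain ⟨i, -, hi⟩ := D.exists_zero 0
  exact hi ▸ h.digit_mem i

theorem InfiniteDesign.IsPurelyPeriodicWith.one_mem (h : D.IsPurelyPeriodicWith P) : 1 ∈ P := by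
  obtain ⟨i, -, hi⟩ := D.exists_one 0
  exact hi ▸ h.digit_mem i

theorem InfiniteDesign.IsPurelyPeriodicWith.foldr_decimal (h : D.IsPurelyPeriodicWith P) :
    P.foldr prependDigit D.decimal = D.decimal := by
  have hper : (fun i => D.digit (i + P.length)) = D.digit := by
    funext i
    have := h.2 (i + P.length)
    rw [Nat.add_mod_right, h.2 i] at this
    exact (Option.some.inj this).symm
  have := ofDigits_eq_foldr P D.digit fun i hi => by
    have := h.2 i
    rwa [Nat.mod_eq_of_lt hi] at this
  rw [hper] at this
  exact this.symm

/-- The assembly function sends a purely periodic design to the positive fixed point of the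
Möbius transformation of its period. -/
theorem assembly_decimal_eq (h : D.IsPurelyPeriodicWith P) {x : ℝ} (hx : 0 < x)
    (hfix : P.foldr digitAction x = x) : assembly D.decimal = (x : EReal) := by
  have hI : D.decimal ∈ Set.Icc (0 : ℝ) 1 := ⟨Real.ofDigits_nonneg _, Real.ofDigits_le_one _⟩
  have hθ : D.decimal ∈ Set.Ioo (0 : ℝ) 1 := by
    rw [← h.foldr_decimal]
    exact ⟨foldr_prependDigit_pos h.one_mem hI, foldr_prependDigit_lt_one h.zero_mem hI⟩
  rw [assembly, if_neg hθ.2.ne, extendFrom_eq (mem_closure_dyadicSet hθ.1.le hθ.2)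
    (tendsto_rationalAssembly h.zero_mem hx hfix hθ h.foldr_decimal)]

/-- A word containing both letters is the period of an infinite design. -/
theorem exists_isPurelyPeriodicWith (h0 : 0 ∈ P) (h1 : 1 ∈ P) :
    ∃ D : InfiniteDesign, D.IsPurelyPeriodicWith P := by
  have hP : P ≠ [] := List.ne_nil_of_mem h0
  have hlen : 0 < P.length := List.length_pos_iff.2 hP
  have hex : ∀ e ∈ P, ∀ N : ℕ, ∃ i : ℕ, N ≤ i ∧
      P[i % P.length]'(Nat.mod_lt _ hlen) = e := by
    intro e he N
    obtain ⟨j, hj, rfl⟩ := List.getElem_of_mem he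
    refine ⟨j + P.length * N, ?_, ?_⟩
    · nlinarith
    · simp [Nat.mod_eq_of_lt hj]
  exact ⟨⟨fun i => P[i % P.length]'(Nat.mod_lt _ hlen), hex 1 h1, hex 0 h0⟩, hP, fun i => by
    simp [Nat.mod_lt _ hlen]⟩

/-- The diagonal entries of the matrix of a palindrome cancel in its fixed point equation
`c * x ^ 2 + (d - a) * x - b = 0`. -/
theorem foldr_digitAction_eq_self_of_palindrome (hP : P.Palindrome) {x : ℝ} (hx : 0 < x)
    (h : wordMatrix P 1 0 * x ^ 2 = wordMatrix P 0 1) : P.foldr digitAction x = x := by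
  have hd : (0 : ℝ) < wordMatrix P 1 1 := Nat.cast_pos.2 (wordMatrix_diag_pos P).2
  rw [foldr_digitAction P hx.le, (palindrome_iff_wordMatrix P).1 hP, div_eq_iff (by positivity),
    ← h]
  ring

end SternDesign

/-! ### Square roots of rational numbers -/

open SternDesign in
theorem corollary7p10 (Q : ℚ) (hQ : 0 < Q) :
    SternDesign.IsQuadraticIrrational (Real.sqrt (Q : ℝ)) ↔
      ∃ (D : SternDesign.InfiniteDesign) (P : List (Fin 2)),
        D.IsPurelyPeriodicWith P ∧ P.Palindrome ∧
          ((Real.sqrt (Q : ℝ) : ℝ) : EReal) = SternDesign.assembly D.decimal := by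
  have hQR : (0 : ℝ) < (Q : ℝ) := Rat.cast_pos.2 hQ
  have hs : 0 < Real.sqrt (Q : ℝ) := Real.sqrt_pos.2 hQR
  have hsq : Real.sqrt (Q : ℝ) ^ 2 = Q := Real.sq_sqrt hQR.le
  have hdQ : (0 : ℚ) < Q.den := Nat.cast_pos.2 Q.den_pos
  have hmul : Q * Q.den = Q.num := Rat.mul_den_eq_num Q
  constructor
  · rintro ⟨hirr, -⟩
    rw [irrational_sqrt_ratCast_iff_of_nonneg hQ.le] at hirr
    have hnum : 0 < Q.num := Rat.num_pos.2 hQ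
    have hpos : 0 < Q.num * Q.den := mul_pos hnum (by exact_mod_cast Q.den_pos)
    have hns : ¬ IsSquare (Q.num * (Q.den : ℤ)) := by
      rintro ⟨k, hk⟩
      refine hirr ⟨k / Q.den, ?_⟩
      have hk' : (Q.num : ℚ) * Q.den = k * k := by exact_mod_cast hk
      rw [div_mul_div_comm, eq_div_iff (by positivity), ← hk', ← hmul]
      ring
    obtain ⟨X, Y, hXY, hY⟩ := Pell.exists_of_not_isSquare hpos hns
    obtain ⟨p, hp⟩ := Int.eq_ofNat_of_zero_le hnum.le
    have hy : 0 < Y.natAbs := Int.natAbs_pos.2 hY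
    have hdet : X.natAbs * X.natAbs = (p * Y.natAbs) * (Q.den * Y.natAbs) + 1 := by
      zify
      rw [← pow_two, sq_abs]
      rw [hp] at hXY
      linear_combination hXY - p * Q.den * (sq_abs Y)
    obtain ⟨P, hP⟩ := exists_wordMatrix_eq hdet
    have hp0 : 0 < p := by omega
    have h01 : 1 ∈ P := by
      rw [← wordMatrix_zero_one_pos_iff, hP]
      exact Nat.mul_pos hp0 hy
    have h10 : 0 ∈ P := by
      rw [← wordMatrix_one_zero_pos_iff, hP]
      exact Nat.mul_pos Q.den_pos hy
    have hpal : P.Palindrome := by simp [palindrome_iff_wordMatrix, hP]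
    obtain ⟨D, hD⟩ := exists_isPurelyPeriodicWith h10 h01
    refine ⟨D, P, hD, hpal, (assembly_decimal_eq hD hs
      (foldr_digitAction_eq_self_of_palindrome hpal hs ?_)).symm⟩
    have hmulR : (Q : ℝ) * Q.den = p := by
      rw [hp] at hmul
      exact_mod_cast hmul
    rw [hsq, hP]
    simp only [Matrix.of_apply, Matrix.cons_val', Matrix.cons_val_zero, Matrix.cons_val_one,
      Matrix.cons_val_fin_one]
    push_cast
    linear_combination (Y.natAbs : ℝ) * hmulR
  · rintro ⟨D, P, hD, hpal, hA⟩
    have hb := (wordMatrix_zero_one_pos_iff P).2 hD.one_mem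
    have hc := (wordMatrix_one_zero_pos_iff P).2 hD.zero_mem
    have hdet := wordMatrix_det P
    have hfix := fun x hx => foldr_digitAction_eq_self_of_palindrome (x := x) hpal hx
    rw [← (palindrome_iff_wordMatrix P).1 hpal] at hdet
    generalize wordMatrix P 0 0 = a, wordMatrix P 0 1 = b, wordMatrix P 1 0 = c at *
    have hcR : (0 : ℝ) < c := Nat.cast_pos.2 hc
    have hbR : (0 : ℝ) < b := Nat.cast_pos.2 hb
    have hx : 0 < Real.sqrt (b / c : ℝ) := Real.sqrt_pos.2 (by positivity)
    rw [assembly_decimal_eq hD hx (hfix _ hx (by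
      rw [Real.sq_sqrt (by positivity)]; field_simp)), EReal.coe_eq_coe_iff] at hA
    have hQbc : Q * c = b := by
      have : (Q : ℝ) * c = b := by
        rw [← hsq, hA, Real.sq_sqrt (by positivity)]
        field_simp
      exact_mod_cast this
    refine ⟨(irrational_sqrt_ratCast_iff_of_nonneg hQ.le).2 ?_, Q.den, 0, -Q.num, ?_, ?_⟩
    · rintro ⟨r, hr⟩
      -- `r * c` is a rational square root of `b * c = a ^ 2 - 1`.
      have hsqQ : IsSquare ((b * c : ℕ) : ℚ) := ⟨r * c, by
        push_cast
        rw [← hQbc, hr]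
        ring⟩
      obtain ⟨k, hk⟩ := Rat.isSquare_natCast_iff.1 hsqQ
      rw [hk] at hdet
      have hk0 : 0 < k := by
        rw [Nat.pos_iff_ne_zero]
        rintro rfl
        have := Nat.mul_pos hb hc
        omega
      -- `a ^ 2 = k ^ 2 + 1` with `k > 0` lies strictly between `k ^ 2` and `(k + 1) ^ 2`.
      have hlt : k < a := by nlinarith
      nlinarith
    · exact_mod_cast Q.den_pos.ne'
    · rw [hsq]
      have hmulR : (Q : ℝ) * Q.den = Q.num := by exact_mod_cast hmul
      push_cast
      linear_combination hmulR
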